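/- Let $d\ge 1$, $G=\mathbb Z^d$, and let $\Sigma$ be a finite alphabet. Equip $\Sigma^G$ with the product topology and the shift action $(gx)(h)=x(h+g)$; for $x\in\Sigma^G$ let $\overline{O_G}(x)$ be the closure of its orbit. A subshift is strictly ergodic if it is minimal and has exactly one $G$-invariant Borel probability measure. Its topological entropy is $h_{\mathrm{top}}(X,G)=\lim_{n\to\infty}\frac{1}{\#F_n}\log\theta_{F_n}(X)$, where $(F_n)$ is any Følner sequence in $G$ and $\theta_M(X)$ is the number of blocks $B\in\Sigma^M$ with $y|_M=B$ for some $y\in X$; the limit exists for every Følner sequence and does not depend on it. An array $x\in\Sigma^G$ is Toeplitz if for every $g\in G$ there is a finite index subgroup $\Gamma\le G$ with $x(g+\gamma)=x(g)$ for all $\gamma\in\Gamma$. For $\alpha\in\Sigma$ let $\mathrm{Per}(x,\Gamma,\alpha)=\{g\in G: x(g+\gamma)=\alpha\ \text{for all}\ \gamma\in\Gamma\}$ and $\mathrm{Per}(x,\Gamma)=\bigcup_{\alpha\in\Sigma}\mathrm{Per}(x,\Gamma,\alpha)$. A period structure of $x$ is a decreasing sequence $(\Gamma_n)$ of finite index subgroups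 of $G$ such that $G=\bigcup_n\mathrm{Per}(x,\Gamma_n)$ and, for every $n$, $\mathrm{Per}(x,\Gamma_n)\ne\emptyset$ and every $h\in G$ with $\mathrm{Per}(x,\Gamma_n,\alpha)\subseteq\mathrm{Per}(x,\Gamma_n,\alpha)-h$ for all $\alpha\in\Sigma$ lies in $\Gamma_n$. Let $x\in\Sigma^G$ be a Toeplitz array with a period structure of the form $\Gamma_n=P_n\mathbb Z^d$, where the $P_n\in\mathbb Z^{d\times d}$ are diagonal matrices with positive diagonal entries and $P_{n+1}\in P_n\cdot\mathbb Z^{d\times d}$ for all $n$. Let $P\in\mathbb Z^{d\times d}$ be a diagonal matrix with positive diagonal entries, let $D=P([0,1)^d)\cap\mathbb Z^d$, let $S:\Sigma\to\Sigma^D$ be an injective map, and define $x^S\in\Sigma^G$ by $$x^S(e+Pg)=[S(x(g))](e)\qquad(e\in D,\ g\in\mathbb Z^d).$$ If $(\overline{O_G}(x),G)$ is strictly ergodic, then $x^S$ is a Toeplitz array, $(\overline{O_G}(x^S),G)$ is strictly ergodic, and $$h_{\mathrm{top}}(\overline{O_G}(x^S),G)=\frac{1}{\#D}\,h_{\mathrm{top}}(\overline{O_G}(x),G).$$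 -/

import Mathlib

open MeasureTheory Filter Topology SymbolicDynamics.FullShift

namespace Toeplitz

section Dynamics

/-- A group action on a topological space with its Borel σ-algebra is uniquely ergodic if there is
exactly one invariant Borel probability measure. -/
def IsUniquelyErgodic (G X : Type*) [AddCommGroup G] [AddAction G X] [TopologicalSpace X]
    [MeasurableSpace X] [BorelSpace X] : Prop :=
  ∃! μ : Measure X, IsProbabilityMeasure μ ∧ VAddInvariantMeasure G X μ

/-- Strictly ergodic: minimal and uniquely ergodic. -/
def IsStrictlyErgodic (G X : Type*) [AddCommGroup G] [AddAction G X] [TopologicalSpace X]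
    [MeasurableSpace X] [BorelSpace X] : Prop :=
  AddAction.IsMinimal G X ∧ IsUniquelyErgodic G X

end Dynamics

section Subshifts

variable {G A : Type*} [AddCommGroup G] [TopologicalSpace A]

/-- The shift action `(g x)(h) = x (g + h)` of `G` on the points of a subshift. -/
instance subshiftAction (X : Subshift A G) : AddAction G X.carrier where
  vadd g y := ⟨shift g y.1, X.mapsTo g y.2⟩
  zero_vadd y := Subtype.ext (shift_zero y.1)
  add_vadd g h y := Subtype.ext <| by
    change shift (g + h) y.1 = shift g (shift h y.1)
    rw [add_comm, shift_add]

theorem coe_vadd (X : Subshift A G) (g : G) (y : X.carrier) :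
    ((g +ᵥ y : X.carrier) : G → A) = shift g y.1 := rfl

/-- The subshift generated by the array `x`: the closure of its orbit in the full shift. -/
def orbitClosure (x : G → A) : Subshift A G where
  carrier := closure (Set.range fun g : G => shift g x)
  isClosed := isClosed_closure
  mapsTo g := by
    refine Set.MapsTo.closure ?_ (continuous_shift g)
    rintro _ ⟨h, rfl⟩
    exact ⟨h + g, shift_add h g x⟩

/-- The set of all `M`-blocks occurring in the subshift `X`. -/
def blocks (X : Subshift A G) (M : Finset G) : Set (M → A) :=
  {B | ∃ y ∈ X.carrier, ∀ m : M, y m = B m}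

/-- `X` has topological entropy `h`: along every Følner sequence `F` of `G`, the quotients
`log (number of F n-blocks occurring in X) / # (F n)` converge to `h`. -/
def HasTopEntropy [MeasurableSpace G] (X : Subshift A G) (h : ℝ) : Prop :=
  ∀ F : ℕ → Finset G, IsAddFoelner G (Measure.count : Measure G) atTop (fun n => (F n : Set G)) →
    Tendsto (fun n => Real.log ((blocks X (F n)).ncard : ℝ) / ((F n).card : ℝ)) atTop (𝓝 h)

end Subshifts

section ToeplitzArrays

variable {G A : Type*} [AddCommGroup G]

/-- Every position of `x` is periodic with respect to some finite index subgroup. -/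
def IsToeplitz (x : G → A) : Prop :=
  ∀ g : G, ∃ Γ : AddSubgroup G, Γ.FiniteIndex ∧ ∀ γ ∈ Γ, x (g + γ) = x g

/-- `Per(x, Γ, a)`: the positions `g` with `x = a` on `g + Γ`. -/
def PerLetter (x : G → A) (Γ : AddSubgroup G) (a : A) : Set G :=
  {g | ∀ γ ∈ Γ, x (g + γ) = a}

/-- `Per(x, Γ)`: the positions at which `x` is `Γ`-periodic. -/
def Per (x : G → A) (Γ : AddSubgroup G) : Set G :=
  ⋃ a : A, PerLetter x Γ a

/-- `Γ` is an essential period of `x`: `Per(x, Γ)` is non-empty, and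
`Per(x, Γ, a) ⊆ Per(x, Γ, a) - h` for all letters `a` only if `h ∈ Γ`. -/
def IsEssentialPeriod (x : G → A) (Γ : AddSubgroup G) : Prop :=
  (Per x Γ).Nonempty ∧
    ∀ h : G, (∀ a : A, PerLetter x Γ a ⊆ {g | g + h ∈ PerLetter x Γ a}) → h ∈ Γ

/-- A period structure of `x`. -/
structure IsPeriodStructure (x : G → A) (Γ : ℕ → AddSubgroup G) : Prop where
  antitone : Antitone Γ
  finiteIndex : ∀ n, (Γ n).FiniteIndex
  iUnion_per : ⋃ n, Per x (Γ n) = Set.univ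
  essential : ∀ n, IsEssentialPeriod x (Γ n)

end ToeplitzArrays

section Lattice

variable {d : ℕ}

/-- A scale of integer matrices: non-singular, each one dividing the next on the left. -/
def IsScale (P : ℕ → Matrix (Fin d) (Fin d) ℤ) : Prop :=
  ∀ n, (P n).det ≠ 0 ∧ ∃ Q : Matrix (Fin d) (Fin d) ℤ, P (n + 1) = P n * Q

/-- The subgroup `P ℤ^d` of `ℤ^d`. -/
def latticeOf (P : Matrix (Fin d) (Fin d) ℤ) : AddSubgroup (Fin d → ℤ) :=
  P.mulVecLin.toAddMonoidHom.range

/-- The box `P [0,1)^d ∩ ℤ^d` for a diagonal matrix `P` with positive diagonal entries. -/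
noncomputable def box (P : Matrix (Fin d) (Fin d) ℤ) : Finset (Fin d → ℤ) :=
  Fintype.piFinset fun i => Finset.Ico 0 (P i i)

theorem mem_box {P : Matrix (Fin d) (Fin d) ℤ} {g : Fin d → ℤ} :
    g ∈ box P ↔ ∀ i, 0 ≤ g i ∧ g i < P i i := by
  simp [box]

/-- The coordinatewise remainder of `g` modulo the diagonal of `P`, a point of the box. -/
noncomputable def remainder (P : Matrix (Fin d) (Fin d) ℤ) (hP : ∀ i, 0 < P i i) (g : Fin d → ℤ) : box P :=
  ⟨fun i => g i % P i i,
    mem_box.2 fun i => ⟨Int.emod_nonneg _ (hP i).ne', Int.emod_lt_of_pos _ (hP i)⟩⟩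

/-- The block substitution: the array `y^S`, in which the block at `P h + box P` is `S (y h)`
(see `substitute_apply`). -/
noncomputable def substitute {A : Type*} (P : Matrix (Fin d) (Fin d) ℤ) (hP : ∀ i, 0 < P i i)
    (S : A → (box P → A)) (y : (Fin d → ℤ) → A) : (Fin d → ℤ) → A :=
  fun g => S (y fun i => g i / P i i) (remainder P hP g)

theorem substitute_apply {A : Type*} (P : Matrix (Fin d) (Fin d) ℤ) (hP : ∀ i, 0 < P i i)
    (hPd : P.IsDiag) (S : A → (box P → A)) (y : (Fin d → ℤ) → A) (h : Fin d → ℤ) (e : box P) :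
    substitute P hP S y (e.1 + P.mulVec h) = S (y h) e := by
  have he := mem_box.1 e.2
  have hmul : ∀ i, P.mulVec h i = P i i * h i := fun i => by
    rw [Matrix.mulVec, dotProduct]
    exact Finset.sum_eq_single i
      (fun j _ hj => by rw [hPd (Ne.symm hj), zero_mul]) (fun hi => absurd (Finset.mem_univ i) hi)
  have h1 : (fun i => (e.1 + P.mulVec h) i / P i i) = h := funext fun i => by
    rw [Pi.add_apply, hmul, Int.add_mul_ediv_left _ _ (hP i).ne',
      Int.ediv_eq_zero_of_lt (he i).1 (he i).2, zero_add]
  have h2 : remainder P hP (e.1 + P.mulVec h) = e := Subtype.ext <| funext fun i => by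
    change (e.1 + P.mulVec h) i % P i i = e.1 i
    rw [Pi.add_apply, hmul, Int.add_mul_emod_self_left, Int.emod_eq_of_lt (he i).1 (he i).2]
  rw [substitute, h1, h2]

end Lattice

end Toeplitz

/-! Let X and Y be the orbit closures of x and `x^S`. The map `y ↦ y^S` embeds X in Y and turns the
shift by h into the shift by Rh. Every point of Y is a shift of some `y^S` by an element of the box
(`exists_eq_shift_substitute`), so finitely many translates of the copy of X cover Y; they may
overlap.

Periods of x scaled by R are periods of `x^S`, and orbit closures of Toeplitz arrays are minimal. An
invariant measure on Y pulls back to a multiple of the one on X, and invariance carries this to each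
translate, which gives uniqueness. Averaging over the cosets of `R ℤ^d` gives existence.

For entropy, Shearer's inequality for the translates of a finite set K bounds the log count on F by
`#(F - K) / #K` times that on K. Hence the limit along every Følner sequence is the infimum over K.
Its value is read off from boxes: if p n and q n are the log counts of X on the cube of side n and
of Y on its R-scaled box, then `p n ≤ q n ≤ log #D + p (n + 1)`. -/

namespace Toeplitz

/-! ### Pattern counts and Shearer's inequality -/

section BlockCount

variable {G H A B : Type*}

/-- The patterns on `M` occurring in members of the family `Y`. -/
def patterns (Y : Set (G → A)) (M : Finset G) : Set (M → A) :=
  {p | ∃ y ∈ Y, ∀ m : M, y m = p m}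

/-- The number of patterns on `M` occurring in members of the family `Y`. -/
noncomputable def patternCount (Y : Set (G → A)) (M : Finset G) : ℕ :=
  (patterns Y M).ncard

/-- Choosing a representative of each pattern and applying φ gives an injection between the pattern
sets. The comparisons of counts below rest on this. -/
theorem patternCount_le_of_determines [Finite B] {Y : Set (G → A)} {Z : Set (H → B)}
    {M : Finset G} {N : Finset H} (φ : (G → A) → (H → B)) (hφ : ∀ y ∈ Y, φ y ∈ Z)
    (hinj : ∀ y ∈ Y, ∀ y' ∈ Y, (∀ n ∈ N, φ y n = φ y' n) → ∀ m ∈ M, y m = y' m) :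
    patternCount Y M ≤ patternCount Z N := by
  have hrep : ∀ p : patterns Y M, ∃ y ∈ Y, ∀ m : M, y m = p.1 m := fun p => p.2
  choose σ hσ hσp using hrep
  let f : patterns Y M → patterns Z N := fun p =>
    ⟨fun n => φ (σ p) n, φ (σ p), hφ _ (hσ p), fun _ => rfl⟩
  have hf : Function.Injective f := fun p q hpq => by
    refine Subtype.ext (funext fun m => ?_)
    rw [← hσp p m, ← hσp q m]
    refine hinj _ (hσ p) _ (hσ q) (fun n hn => ?_) m m.2
    exact congrFun (congrArg Subtype.val hpq) ⟨n, hn⟩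
  exact Nat.card_le_card_of_injective f hf

theorem patternCount_empty_left (M : Finset G) : patternCount (∅ : Set (G → A)) M = 0 := by
  simp [patternCount, patterns]

variable [Finite A]

theorem patternCount_mono {Y Z : Set (G → A)} (h : Y ⊆ Z) (M : Finset G) :
    patternCount Y M ≤ patternCount Z M :=
  patternCount_le_of_determines id h fun _ _ _ _ h => h

theorem patternCount_pos {Y : Set (G → A)} (hY : Y.Nonempty) (M : Finset G) :
    0 < patternCount Y M := by
  obtain ⟨y, hy⟩ := hY
  exact (Set.ncard_pos (Set.toFinite _)).2 ⟨fun m => y m, y, hy, fun _ => rfl⟩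

theorem patternCount_empty_right_le (Y : Set (G → A)) : patternCount Y ∅ ≤ 1 := by
  refine (Set.ncard_le_one (Set.toFinite _)).2 fun p _ q _ => ?_
  exact funext fun m => absurd m.2 (Finset.notMem_empty _)

theorem patternCount_iUnion_le {ι : Type*} (s : Finset ι) (Z : ι → Set (G → A))
    {Y : Set (G → A)} (h : ∀ y ∈ Y, ∃ i ∈ s, y ∈ Z i) (M : Finset G) :
    patternCount Y M ≤ ∑ i ∈ s, patternCount (Z i) M := by
  have hsub : patterns Y M ⊆ ⋃ i ∈ s, patterns (Z i) M := by
    rintro p ⟨y, hy, hp⟩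
    obtain ⟨i, hi, hyi⟩ := h y hy
    exact Set.mem_biUnion (x := i) hi ⟨y, hyi, hp⟩
  exact (Set.ncard_le_ncard hsub (Set.toFinite _)).trans (s.set_ncard_biUnion_le _)

/-- Since g lies in M, a pattern on M records the letter at g, so distinct fibres have disjoint
pattern sets. -/
theorem sum_patternCount_fiber_le [Fintype A] (Y : Set (G → A)) {g : G} {M : Finset G}
    (hg : g ∈ M) :
    ∑ a : A, patternCount {y ∈ Y | y g = a} M ≤ patternCount Y M := by
  classical
  have hdisj : Pairwise fun a b : A => Disjoint (patterns {y ∈ Y | y g = a} M)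
      (patterns {y ∈ Y | y g = b} M) := fun a b hab => by
    refine Set.disjoint_left.2 ?_
    rintro p ⟨y, ⟨-, hy⟩, hp⟩ ⟨z, ⟨-, hz⟩, hq⟩
    exact hab (by rw [← hy, ← hz, hp ⟨g, hg⟩, hq ⟨g, hg⟩])
  have hsub : ⋃ a : A, patterns {y ∈ Y | y g = a} M ⊆ patterns Y M := by
    refine Set.iUnion_subset fun a => ?_
    rintro p ⟨y, ⟨hy, -⟩, hp⟩
    exact ⟨y, hy, hp⟩
  have h := Set.ncard_le_ncard hsub (Set.toFinite _)
  rw [Set.ncard_iUnion_of_finite (fun a => Set.toFinite _) hdisj, finsum_eq_sum_of_fintype] at h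
  exact h

/-- Factors outside T' are at most 1 and can be dropped; the rest is AM-GM with equal weights. -/
theorem prod_rpow_inv_le_average {ι : Type*} [DecidableEq ι] (T T' : Finset ι) (hT' : T' ⊆ T)
    (hne : T'.Nonempty) (z : ι → ℝ) (h0 : ∀ t ∈ T, 0 ≤ z t) (h1 : ∀ t ∈ T, z t ≤ 1) :
    ∏ t ∈ T, z t ^ ((T'.card : ℝ)⁻¹) ≤ (T'.card : ℝ)⁻¹ * ∑ t ∈ T', z t := by
  have hc : (0 : ℝ) < T'.card := by exact_mod_cast hne.card_pos
  calc ∏ t ∈ T, z t ^ ((T'.card : ℝ)⁻¹) ≤ ∏ t ∈ T', z t ^ ((T'.card : ℝ)⁻¹) := by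
        refine Finset.prod_le_prod_of_subset_of_le_one hT' (fun t ht => ?_) fun t ht _ => ?_
        · exact Real.rpow_nonneg (h0 t ht) _
        · exact Real.rpow_le_one (h0 t ht) (h1 t ht) (by positivity)
    _ ≤ ∑ t ∈ T', (T'.card : ℝ)⁻¹ * z t :=
        Real.geom_mean_le_arith_mean_weighted T' _ _ (fun _ _ => by positivity)
          (by simp [hc.ne']) fun t ht => h0 t (hT' ht)
    _ = _ := by rw [Finset.mul_sum]

/-- **Shearer's inequality** for pattern counts: if every point of `F` is covered at least `k`
times by the sets `K t`, then the number of patterns on `F` is at most the product of the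
`k`-th roots of the numbers of patterns on the sets `K t`. -/
theorem patternCount_le_prod_rpow {ι : Type*} [DecidableEq G] (T : Finset ι)
    (K : ι → Finset G) {k : ℕ} (hk : 0 < k) (F : Finset G) (hcov : ∀ g ∈ F, k ≤ (T.filter fun t => g ∈ K t).card)
    (Y : Set (G → A)) :
    (patternCount Y F : ℝ) ≤ ∏ t ∈ T, (patternCount Y (K t) : ℝ) ^ ((k : ℝ)⁻¹) := by
  classical
  have := Fintype.ofFinite A
  induction F using Finset.induction_on generalizing Y with
  | empty =>
    rcases Y.eq_empty_or_nonempty with rfl | hY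
    · rw [patternCount_empty_left]; push_cast; positivity
    · calc (patternCount Y ∅ : ℝ) ≤ 1 := by exact_mod_cast patternCount_empty_right_le Y
        _ ≤ _ := Finset.one_le_prod fun t _ => Real.one_le_rpow
            (by exact_mod_cast patternCount_pos hY (K t)) (by positivity)
  | insert g F hg ih =>
    rcases Y.eq_empty_or_nonempty with rfl | hY
    · rw [patternCount_empty_left]; push_cast; positivity
    -- Exactly k of the sets through g are kept, so that the weights 1/k sum to one.
    obtain ⟨T', hT', hcard⟩ := Finset.exists_subset_card_eq (hcov g (Finset.mem_insert_self g F))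
    have hT'T : T' ⊆ T := hT'.trans (Finset.filter_subset _ _)
    have hT'ne : T'.Nonempty := Finset.card_pos.1 (hcard ▸ hk)
    have hW : ∀ t, (0 : ℝ) < patternCount Y (K t) := fun t => by
      exact_mod_cast patternCount_pos hY (K t)
    set W : ℝ := ∏ t ∈ T, (patternCount Y (K t) : ℝ) ^ ((k : ℝ)⁻¹) with hWdef
    have hWpos : 0 < W := Finset.prod_pos fun t _ => Real.rpow_pos_of_pos (hW t) _
    -- The induction hypothesis is applied to the fibre `y g = a`; dividing each count by that of Y
    -- leaves ratios in [0, 1] with W factored out.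
    have hfib : ∀ a, (patternCount {y ∈ Y | y g = a} F : ℝ) ≤
        W * ((k : ℝ)⁻¹ * ∑ t ∈ T', (patternCount {y ∈ Y | y g = a} (K t) : ℝ) /
          patternCount Y (K t)) := fun a => by
      refine (ih (fun g' hg' => hcov g' (Finset.mem_insert_of_mem hg')) _).trans ?_
      have := prod_rpow_inv_le_average T T' hT'T hT'ne
        (fun t => (patternCount {y ∈ Y | y g = a} (K t) : ℝ) / patternCount Y (K t))
        (fun t _ => by positivity) fun t _ => (div_le_one (hW t)).2 (by
          exact_mod_cast patternCount_mono (Set.sep_subset _ _) _)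
      rw [hcard] at this
      refine le_trans (le_of_eq ?_) (mul_le_mul_of_nonneg_left this hWpos.le)
      rw [hWdef, ← Finset.prod_mul_distrib]
      refine Finset.prod_congr rfl fun t _ => ?_
      rw [← Real.mul_rpow (hW t).le (by positivity), mul_div_cancel₀ _ (hW t).ne']
    have hsplit : patternCount Y (insert g F) ≤ ∑ a : A, patternCount {y ∈ Y | y g = a} F := by
      refine (patternCount_iUnion_le Finset.univ (fun a => {y ∈ Y | y g = a})
        (fun y hy => ⟨y g, Finset.mem_univ _, hy, rfl⟩) _).trans (Finset.sum_le_sum fun a _ => ?_)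
      refine patternCount_le_of_determines id (fun _ h => h) fun y hy z hz h m hm => ?_
      rcases Finset.mem_insert.1 hm with rfl | hm
      · rw [hy.2, hz.2]
      · exact h m hm
    calc (patternCount Y (insert g F) : ℝ)
        ≤ ∑ a : A, (patternCount {y ∈ Y | y g = a} F : ℝ) := by exact_mod_cast hsplit
      _ ≤ ∑ a : A, W * ((k : ℝ)⁻¹ * ∑ t ∈ T', (patternCount {y ∈ Y | y g = a} (K t) : ℝ) /
          patternCount Y (K t)) := Finset.sum_le_sum fun a _ => hfib a
      _ = W * ((k : ℝ)⁻¹ * ∑ t ∈ T', (∑ a : A, (patternCount {y ∈ Y | y g = a} (K t) : ℝ)) /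
          patternCount Y (K t)) := by
        rw [← Finset.mul_sum, ← Finset.mul_sum, Finset.sum_comm]
        simp_rw [Finset.sum_div]
      _ ≤ W * ((k : ℝ)⁻¹ * ∑ t ∈ T', 1) := by
        -- Each t in T' has g in K t, so its fibre ratios sum over the letters to at most 1.
        gcongr with t ht
        refine (div_le_one (hW t)).2 ?_
        exact_mod_cast sum_patternCount_fiber_le Y (Finset.mem_filter.1 (hT' ht)).2
      _ = W := by
        have : (k : ℝ) ≠ 0 := by exact_mod_cast hk.ne'
        simp [hcard, this]

theorem log_patternCount_le_sum {ι : Type*} [DecidableEq G] (T : Finset ι) (K : ι → Finset G)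
    {k : ℕ} (hk : 0 < k) (F : Finset G)
    (hcov : ∀ g ∈ F, k ≤ (T.filter fun t => g ∈ K t).card)
    {Y : Set (G → A)} (hY : Y.Nonempty) :
    Real.log (patternCount Y F) ≤ (k : ℝ)⁻¹ * ∑ t ∈ T, Real.log (patternCount Y (K t)) := by
  have hpos : ∀ M, (0 : ℝ) < patternCount Y M := fun M => by
    exact_mod_cast patternCount_pos hY M
  refine (Real.log_le_log (hpos F) (patternCount_le_prod_rpow T K hk F hcov Y)).trans_eq ?_
  rw [Real.log_prod fun t _ => (Real.rpow_pos_of_pos (hpos _) _).ne', Finset.mul_sum]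
  exact Finset.sum_congr rfl fun t _ => Real.log_rpow (hpos _) _

end BlockCount

/-! ### Existence of entropy along Følner sequences -/

section Entropy

open scoped Pointwise symmDiff

variable {G A : Type*} [AddCommGroup G] [TopologicalSpace A] [Finite A]

theorem patternCount_vadd_le [DecidableEq G] (X : Subshift A G) (t : G) (K : Finset G) :
    patternCount X.carrier (t +ᵥ K) ≤ patternCount X.carrier K := by
  refine patternCount_le_of_determines (shift t) (fun y hy => X.mapsTo t hy)
    fun y _ z _ h m hm => ?_
  obtain ⟨k, hk, rfl⟩ := Finset.mem_vadd_finset.1 hm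
  exact h k hk

/-- Shearer's inequality for the translates t + K with t in F - K: a point g of F is covered once
for each k in K, by t = g - k. -/
theorem log_patternCount_le_mul [DecidableEq G] {X : Subshift A G} (hX : X.carrier.Nonempty)
    {K : Finset G} (hK : K.Nonempty) (F : Finset G) :
    Real.log (patternCount X.carrier F) ≤
      ((F - K).card : ℝ) * (Real.log (patternCount X.carrier K) / K.card) := by
  have hcov : ∀ g ∈ F, K.card ≤ ((F - K).filter fun t => g ∈ t +ᵥ K).card := fun g hg => by
    rw [← Finset.card_image_of_injective K (sub_right_injective (b := g))]
    refine Finset.card_le_card fun t ht => ?_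
    obtain ⟨k, hk, rfl⟩ := Finset.mem_image.1 ht
    exact Finset.mem_filter.2 ⟨Finset.sub_mem_sub hg hk,
      Finset.mem_vadd_finset.2 ⟨k, hk, sub_add_cancel g k⟩⟩
  have hpos : ∀ M, (0 : ℝ) < patternCount X.carrier M := fun M => by
    exact_mod_cast patternCount_pos hX M
  refine (log_patternCount_le_sum (F - K) (fun t => t +ᵥ K) hK.card_pos F hcov hX).trans ?_
  calc (K.card : ℝ)⁻¹ * ∑ t ∈ F - K, Real.log (patternCount X.carrier (t +ᵥ K))
      ≤ (K.card : ℝ)⁻¹ * ∑ t ∈ F - K, Real.log (patternCount X.carrier K) := by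
        gcongr with t _
        · exact hpos _
        · exact patternCount_vadd_le X t K
    _ = _ := by
        rw [Finset.sum_const, nsmul_eq_mul]; ring

/-- F - K is the union of the translates -k + F, each leaving F only in a boundary part that is
negligible along a Følner sequence. -/
theorem card_sub_le [DecidableEq G] (F K : Finset G) :
    (F - K).card ≤ F.card + ∑ k ∈ K, ((-k +ᵥ F) \ F).card := by
  have hsub : F - K ⊆ F ∪ K.biUnion fun k => (-k +ᵥ F) \ F := fun t ht => by
    obtain ⟨f, hf, k, hk, rfl⟩ := Finset.mem_sub.1 ht
    by_cases h : f - k ∈ F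
    · exact Finset.mem_union_left _ h
    · refine Finset.mem_union_right _ (Finset.mem_biUnion.2 ⟨k, hk, Finset.mem_sdiff.2 ⟨?_, h⟩⟩)
      exact Finset.mem_vadd_finset.2 ⟨f, hf, neg_add_eq_sub k f⟩
  refine (Finset.card_le_card hsub).trans ((Finset.card_union_le _ _).trans ?_)
  gcongr
  exact Finset.card_biUnion_le

variable [MeasurableSpace G] [MeasurableSingletonClass G]

theorem isAddFoelner_count_iff [DecidableEq G] (F : ℕ → Finset G) :
    IsAddFoelner G (Measure.count : Measure G) atTop (fun n => (F n : Set G)) ↔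
      (∀ᶠ n in atTop, (F n).Nonempty) ∧
        ∀ g : G, Tendsto (fun n => (((g +ᵥ F n) ∆ F n).card : ℝ) / (F n).card) atTop (𝓝 0) := by
  have hne : ∀ n, (Measure.count : Measure G) (F n) ≠ 0 ↔ (F n).Nonempty := fun n => by
    rw [Measure.count_apply_finset]
    simp [Finset.nonempty_iff_ne_empty]
  have hcoe : ∀ (g : G) n, (g +ᵥ (F n : Set G)) ∆ (F n : Set G) =
      (((g +ᵥ F n) ∆ F n : Finset G) : Set G) := fun g n => by
    push_cast; rfl
  have htop : ∀ g : G, ∀ n, (Measure.count : Measure G) ((g +ᵥ (F n : Set G)) ∆ (F n : Set G)) /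
      (Measure.count : Measure G) (F n) ≠ ⊤ := fun g n => by
    rw [hcoe, Measure.count_apply_finset, Measure.count_apply_finset]
    -- For an empty set the quotient is 0 / 0 = 0, hence still finite.
    rcases (F n).eq_empty_or_nonempty with h | h
    · simp [h]
    · exact (ENNReal.div_lt_top (by simp) (by simpa using h.ne_empty)).ne
  have key : ∀ g : G,
      (Tendsto (fun n => (Measure.count : Measure G) ((g +ᵥ (F n : Set G)) ∆ (F n : Set G)) /
        (Measure.count : Measure G) (F n)) atTop (𝓝 0) ↔
      Tendsto (fun n => (((g +ᵥ F n) ∆ F n).card : ℝ) / (F n).card) atTop (𝓝 0)) := fun g => by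
    rw [← ENNReal.tendsto_toReal_iff (htop g) ENNReal.zero_ne_top]
    simp_rw [hcoe, Measure.count_apply_finset]
    simp
  constructor
  · intro h
    have h1 : ∀ᶠ n in atTop, (F n).Nonempty := by
      filter_upwards [h.eventually_meas_ne_zero] with n hn using (hne n).1 hn
    exact ⟨h1, fun g => (key g).1 (h.tendsto_meas_vadd_symmDiff g)⟩
  · rintro ⟨h1, h2⟩
    refine ⟨.of_forall fun n => (F n).measurableSet, ?_, .of_forall fun n => ?_,
      fun g => (key g).2 (h2 g)⟩
    · filter_upwards [h1] with n hn using (hne n).2 hn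
    · rw [Measure.count_apply_finset]; simp

/-- Every non-empty subshift over an abelian group has a topological entropy, namely the infimum
of the normalised logarithmic pattern counts over all non-empty finite sets. -/
theorem hasTopEntropy_iInf {X : Subshift A G} (hX : X.carrier.Nonempty) :
    HasTopEntropy X (⨅ K : {K : Finset G // K.Nonempty},
      Real.log (patternCount X.carrier K.1) / (K.1.card : ℝ)) := by
  classical
  intro F hF
  obtain ⟨hne, hsd⟩ := (isAddFoelner_count_iff F).1 hF
  have hlog : ∀ M, 0 ≤ Real.log (patternCount X.carrier M) := fun M =>
    Real.log_natCast_nonneg _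
  have hbdd : BddBelow (Set.range fun K : {K : Finset G // K.Nonempty} =>
      Real.log (patternCount X.carrier K.1) / (K.1.card : ℝ)) :=
    ⟨0, by rintro _ ⟨K, rfl⟩; exact div_nonneg (hlog _) (Nat.cast_nonneg _)⟩
  have : Nonempty {K : Finset G // K.Nonempty} := ⟨⟨{0}, Finset.singleton_nonempty 0⟩⟩
  refine tendsto_order.2 ⟨fun a ha => ?_, fun a ha => ?_⟩
  · filter_upwards [hne] with n hn
    exact ha.trans_le (ciInf_le hbdd ⟨F n, hn⟩)
  -- A fixed K with value below a bounds the quotients from above, up to a factor tending to 1.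
  · obtain ⟨⟨K, hK⟩, hKa⟩ := exists_lt_of_ciInf_lt ha
    set c := Real.log (patternCount X.carrier K) / (K.card : ℝ) with hc
    have hc0 : 0 ≤ c := div_nonneg (hlog _) (Nat.cast_nonneg _)
    have hlim : Tendsto (fun n => (1 + ∑ k ∈ K, (((-k +ᵥ F n) ∆ F n).card : ℝ) / (F n).card) * c)
        atTop (𝓝 ((1 + ∑ k ∈ K, 0) * c)) :=
      (tendsto_const_nhds.add (tendsto_finsetSum _ fun k _ => hsd (-k))).mul_const c
    rw [Finset.sum_const_zero, add_zero, one_mul] at hlim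
    filter_upwards [hne, (tendsto_order.1 hlim).2 a hKa] with n hn hlt
    refine lt_of_le_of_lt ?_ hlt
    have hn0 : (0 : ℝ) < (F n).card := by exact_mod_cast hn.card_pos
    change Real.log (patternCount X.carrier (F n)) / _ ≤ _
    rw [div_le_iff₀ hn0]
    refine (log_patternCount_le_mul hX hK (F n)).trans ?_
    have hcard : ((F n - K).card : ℝ) ≤
        (1 + ∑ k ∈ K, (((-k +ᵥ F n) ∆ F n).card : ℝ) / (F n).card) * (F n).card := by
      rw [add_mul, one_mul, Finset.sum_mul]
      simp_rw [div_mul_cancel₀ _ hn0.ne']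
      have h1 := card_sub_le (F n) K
      have h2 : ∑ k ∈ K, ((-k +ᵥ F n) \ F n).card ≤ ∑ k ∈ K, ((-k +ᵥ F n) ∆ F n).card :=
        Finset.sum_le_sum fun k _ => Finset.card_le_card le_sup_left
      exact_mod_cast h1.trans (Nat.add_le_add_left h2 _)
    calc ((F n - K).card : ℝ) * c ≤ _ := mul_le_mul_of_nonneg_right hcard hc0
      _ = _ := by ring

end Entropy

/-! ### Transfer of unique ergodicity along an embedding -/

section UniqueErgodicity

variable {G X Y : Type*} [AddCommGroup G] [AddAction G Y]
  [MeasurableSpace X] [MeasurableSpace Y]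

theorem measurableEmbedding_vadd_comp [MeasurableConstVAdd G Y] {s : X → Y}
    (hs : MeasurableEmbedding s) (g : G) : MeasurableEmbedding fun y => g +ᵥ s y :=
  (measurableEmbedding_const_vadd g).comp hs

/-- Invariance moves the mass of the copy of X to each translate, so the single measure `ν.comap s`
governs all the restrictions. -/
theorem restrict_range_vadd [MeasurableConstVAdd G Y] {s : X → Y} (hs : MeasurableEmbedding s)
    (ν : Measure Y) [VAddInvariantMeasure G Y ν] (g : G) :
    ν.restrict (Set.range fun y => g +ᵥ s y) = (ν.comap s).map fun y => g +ᵥ s y := by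
  have hsg := measurableEmbedding_vadd_comp hs g
  rw [← hsg.map_comap]
  congr 1
  ext B _
  rw [hsg.comap_apply, hs.comap_apply, ← measure_vadd ν g (s '' B)]
  congr 1
  rw [← Set.image_vadd, Set.image_image]

variable [AddAction G X]

theorem vaddInvariantMeasure_comap {φ : G →+ G} {s : X → Y} (hs : MeasurableEmbedding s)
    (heq : ∀ g y, s (g +ᵥ y) = φ g +ᵥ s y) (ν : Measure Y) [VAddInvariantMeasure G Y ν] :
    VAddInvariantMeasure G X (ν.comap s) := by
  refine ⟨fun g B hB => ?_⟩
  have himg : s '' ((fun y => g +ᵥ y) ⁻¹' B) = (fun z => φ g +ᵥ z) ⁻¹' (s '' B) := by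
    ext z
    constructor
    · rintro ⟨y, hy, rfl⟩
      exact ⟨g +ᵥ y, hy, heq g y⟩
    · rintro ⟨b, hb, hbz⟩
      refine ⟨-g +ᵥ b, by simpa using hb, ?_⟩
      rw [heq, hbz, map_neg, neg_vadd_vadd]
  rw [hs.comap_apply, hs.comap_apply, himg]
  exact VAddInvariantMeasure.measure_preimage_vadd _ (hs.measurableSet_image.2 hB)

/-- A nonzero finite invariant measure is normalised to the unique probability; the zero measure
needs a separate case. -/
theorem eq_smul_of_unique {μ : Measure X} (hμ : ∀ m : Measure X,
    IsProbabilityMeasure m ∧ VAddInvariantMeasure G X m → m = μ) (m : Measure X)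
    [IsFiniteMeasure m] [VAddInvariantMeasure G X m] : m = m Set.univ • μ := by
  rcases eq_or_ne (m Set.univ) 0 with h0 | h0
  · rw [h0, zero_smul]
    exact Measure.measure_univ_eq_zero.1 h0
  have htop := measure_ne_top m Set.univ
  have h : (m Set.univ)⁻¹ • m = μ := hμ _
    ⟨⟨by rw [Measure.smul_apply, smul_eq_mul, ENNReal.inv_mul_cancel h0 htop]⟩,
      ⟨fun g B hB => by
        rw [Measure.smul_apply, Measure.smul_apply, measure_preimage_vadd]⟩⟩
  rw [← h, smul_smul, ENNReal.mul_inv_cancel h0 htop, one_smul]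

/-- An invariant measure is determined by its restriction to a measurable subset whose translates
cover the space, if that restriction is unique up to scaling. -/
theorem eq_of_unique_of_iUnion_eq_univ [Countable G] [MeasurableConstVAdd G Y] {φ : G →+ G}
    {s : X → Y} (hs : MeasurableEmbedding s) (heq : ∀ g y, s (g +ᵥ y) = φ g +ᵥ s y)
    (hcov : ⋃ g : G, (Set.range fun y => g +ᵥ s y) = Set.univ) {μ : Measure X}
    (hμ : ∀ m : Measure X, IsProbabilityMeasure m ∧ VAddInvariantMeasure G X m → m = μ)
    (ν ν' : Measure Y) [IsProbabilityMeasure ν] [IsProbabilityMeasure ν']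
    [VAddInvariantMeasure G Y ν] [VAddInvariantMeasure G Y ν'] : ν = ν' := by
  -- Here c is the mass of the copy of X. Were it zero, ρ would vanish on every translate, hence
  -- everywhere.
  have key : ∀ (ρ : Measure Y) [IsProbabilityMeasure ρ] [VAddInvariantMeasure G Y ρ],
      ∃ c : ENNReal, c ≠ 0 ∧ c ≠ ⊤ ∧ ∀ g : G, ρ.restrict (Set.range fun y => g +ᵥ s y) =
        c • μ.map fun y => g +ᵥ s y := fun ρ _ _ => by
    have := vaddInvariantMeasure_comap hs heq ρ
    have : IsFiniteMeasure (ρ.comap s) := ⟨by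
      rw [hs.comap_apply]; exact measure_lt_top _ _⟩
    refine ⟨(ρ.comap s) Set.univ, fun h0 => ?_, measure_ne_top _ _, fun g => ?_⟩
    · have hz : ρ = 0 := by
        refine (Measure.ext_iff_of_iUnion_eq_univ hcov).2 fun g => ?_
        rw [restrict_range_vadd hs, Measure.measure_univ_eq_zero.1 h0]
        simp
      exact IsProbabilityMeasure.ne_zero ρ hz
    · rw [restrict_range_vadd hs, ← Measure.map_smul, ← eq_smul_of_unique hμ]
  obtain ⟨c, hc0, hct, hc⟩ := key ν
  obtain ⟨c', hc0', hct', hc'⟩ := key ν'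
  -- Cross-multiplication makes the restrictions agree on each translate; agreement on a countable
  -- cover suffices, without disjointness.
  have h : c' • ν = c • ν' := by
    refine (Measure.ext_iff_of_iUnion_eq_univ hcov).2 fun g => ?_
    rw [Measure.restrict_smul, Measure.restrict_smul, hc, hc', smul_smul, smul_smul, mul_comm]
  have hcc : c' = c := by simpa using congrArg (fun m : Measure Y => m Set.univ) h
  rw [hcc] at h
  ext B _
  have hB := congrArg (fun m : Measure Y => m B) h
  simpa [ENNReal.mul_right_inj hc0 hct] using hB

/-- A difference φ k of the translations is absorbed by the invariance of μ under k, so the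
push-forward depends only on the coset of g. -/
theorem map_vadd_comp_eq [MeasurableConstVAdd G Y] [MeasurableConstVAdd G X] {φ : G →+ G}
    {s : X → Y} (hs : Measurable s) (heq : ∀ g y, s (g +ᵥ y) = φ g +ᵥ s y) (μ : Measure X)
    [VAddInvariantMeasure G X μ] {g h : G} (hgh : -g + h ∈ φ.range) :
    (μ.map fun y => g +ᵥ s y) = μ.map fun y => h +ᵥ s y := by
  obtain ⟨k, hk⟩ := hgh
  have hcomp : (fun y => h +ᵥ s y) = (fun y => g +ᵥ s y) ∘ fun y => k +ᵥ y := funext fun y => by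
    simp only [Function.comp_apply, heq, hk]
    rw [← add_vadd, add_neg_cancel_left]
  have hsg : Measurable fun y => g +ᵥ s y := hs.const_vadd g
  rw [hcomp, ← Measure.map_map hsg (measurable_const_vadd k),
    MeasureTheory.map_vadd]

/-- Averaging the translates of an embedded copy of `X` over a finite quotient of `G` produces an
invariant probability measure. -/
theorem exists_invariant_of_finiteIndex [MeasurableConstVAdd G Y] [MeasurableConstVAdd G X]
    {φ : G →+ G} (hφ : φ.range.FiniteIndex) {s : X → Y} (hs : Measurable s)
    (heq : ∀ g y, s (g +ᵥ y) = φ g +ᵥ s y) (μ : Measure X) [IsProbabilityMeasure μ]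
    [VAddInvariantMeasure G X μ] :
    ∃ ν : Measure Y, IsProbabilityMeasure ν ∧ VAddInvariantMeasure G Y ν := by
  have := Fintype.ofFinite (G ⧸ φ.range)
  have hsm : ∀ g : G, Measurable fun y => g +ᵥ s y := fun g => hs.const_vadd g
  let κ : G ⧸ φ.range → Measure Y := fun q => μ.map fun y => q.out +ᵥ s y
  have hκ : ∀ g : G, κ g = μ.map fun y => g +ᵥ s y := fun g =>
    map_vadd_comp_eq hs heq μ (QuotientAddGroup.eq.1 (QuotientAddGroup.out_eq' (g : G ⧸ φ.range)))
  have hprob : ∀ q, κ q Set.univ = 1 := fun q => by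
    rw [Measure.map_apply (hsm _) MeasurableSet.univ, Set.preimage_univ, measure_univ]
  -- Translation by g permutes the summands, so their average is invariant.
  have hinv : ∀ (g : G) q (B : Set Y), MeasurableSet B →
      κ q ((fun z => g +ᵥ z) ⁻¹' B) = κ ((g : G ⧸ φ.range) + q) B := fun g q B hB => by
    obtain ⟨h, rfl⟩ := QuotientAddGroup.mk_surjective q
    rw [← QuotientAddGroup.mk_add, hκ, hκ, Measure.map_apply (hsm _) (measurable_const_vadd g hB),
      Measure.map_apply (hsm _) hB]
    congr 1
    ext y
    simp [add_vadd]
  have hcard : (Fintype.card (G ⧸ φ.range) : ENNReal) ≠ 0 := by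
    exact_mod_cast Fintype.card_ne_zero
  refine ⟨(Fintype.card (G ⧸ φ.range) : ENNReal)⁻¹ • ∑ q, κ q, ⟨?_⟩, ⟨fun g B hB => ?_⟩⟩
  · simp only [Measure.smul_apply, Measure.finsetSum_apply, hprob]
    simp [ENNReal.inv_mul_cancel hcard]
  · simp only [Measure.smul_apply, Measure.finsetSum_apply, hinv g _ B hB]
    congr 1
    exact Equiv.sum_comp (Equiv.addLeft (g : G ⧸ φ.range)) fun q => κ q B

theorem IsUniquelyErgodic.of_embedding [Countable G] [TopologicalSpace X] [BorelSpace X]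
    [TopologicalSpace Y] [BorelSpace Y] [MeasurableConstVAdd G X] [MeasurableConstVAdd G Y]
    {φ : G →+ G} (hφ : φ.range.FiniteIndex) {s : X → Y} (hs : MeasurableEmbedding s)
    (heq : ∀ g y, s (g +ᵥ y) = φ g +ᵥ s y)
    (hcov : ⋃ g : G, (Set.range fun y => g +ᵥ s y) = Set.univ) (hX : IsUniquelyErgodic G X) :
    IsUniquelyErgodic G Y := by
  obtain ⟨μ, ⟨hμ1, hμ2⟩, hμ⟩ := hX
  obtain ⟨ν, hν1, hν2⟩ := exists_invariant_of_finiteIndex hφ hs.measurable heq μ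
  refine ⟨ν, ⟨hν1, hν2⟩, ?_⟩
  rintro ν' ⟨h1, h2⟩
  exact eq_of_unique_of_iUnion_eq_univ hs heq hcov hμ ν' ν

end UniqueErgodicity

/-! ### Minimality of Toeplitz orbit closures -/

section Minimality

variable {G A : Type*} [AddCommGroup G]

theorem mem_closure_iff_forall_finset {ι A : Type*} [TopologicalSpace A] [DiscreteTopology A]
    {T : Set (ι → A)} {z : ι → A} :
    z ∈ closure T ↔ ∀ M : Finset ι, ∃ y ∈ T, ∀ m ∈ M, y m = z m := by
  rw [mem_closure_iff]
  constructor
  · intro h M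
    obtain ⟨y, hy, hyT⟩ := h _ (isOpen_cylinder M z) fun _ _ => rfl
    exact ⟨y, hyT, hy⟩
  · intro h O hO hz
    obtain ⟨M, u, hu, hsub⟩ := isOpen_pi_iff.1 hO z hz
    obtain ⟨y, hyT, hy⟩ := h M
    exact ⟨y, hsub fun m hm => by rw [hy m hm]; exact (hu m hm).2, hyT⟩

theorem IsToeplitz.exists_common_period {x : G → A} (hx : IsToeplitz x) (M : Finset G) :
    ∃ Γ : AddSubgroup G, Γ.FiniteIndex ∧ ∀ m ∈ M, ∀ γ ∈ Γ, x (m + γ) = x m := by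
  choose Γ hΓ hper using hx
  exact ⟨⨅ m : M, Γ m, AddSubgroup.finiteIndex_iInf fun m => hΓ m,
    fun m hm γ hγ => hper m γ ((AddSubgroup.mem_iInf.1 hγ) ⟨m, hm⟩)⟩

variable [TopologicalSpace A]

theorem continuousConstVAdd_subshift (X : Subshift A G) : ContinuousConstVAdd G X.carrier :=
  ⟨fun g => ((continuous_shift g).comp continuous_subtype_val).subtype_mk _⟩

theorem self_mem_orbitClosure (x : G → A) : x ∈ (orbitClosure x).carrier :=
  subset_closure ⟨0, shift_zero x⟩

theorem orbitClosure_subset {X : Subshift A G} {x : G → A} (hx : x ∈ X.carrier) :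
    (orbitClosure x).carrier ⊆ X.carrier :=
  closure_minimal (by rintro _ ⟨g, rfl⟩; exact X.mapsTo g hx) X.isClosed

variable [DiscreteTopology A]

/-- A window of x recurs along a finite index subgroup Γ. A large enough piece of y copies a shift
of x, and one of finitely many coset representatives realigns it with Γ. -/
theorem IsToeplitz.mem_orbitClosure {x y : G → A} (hx : IsToeplitz x)
    (hy : y ∈ (orbitClosure x).carrier) : x ∈ (orbitClosure y).carrier := by
  classical
  refine mem_closure_iff_forall_finset.2 fun M => ?_
  obtain ⟨Γ, hΓ, hper⟩ := hx.exists_common_period M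
  have := Fintype.ofFinite (G ⧸ Γ)
  let K : Finset G := Finset.univ.image fun q : G ⧸ Γ => q.out
  -- The agreement window K + M is fixed before g is known, so it must serve every coset; k then
  -- represents the class of -g.
  obtain ⟨_, ⟨g, rfl⟩, hg⟩ := mem_closure_iff_forall_finset.1 hy
    ((K ×ˢ M).image fun p => p.1 + p.2)
  let k : G := ((-g : G) : G ⧸ Γ).out
  have hk : k ∈ K := Finset.mem_image_of_mem _ (Finset.mem_univ _)
  have hgk : g + k ∈ Γ := by
    have h := QuotientAddGroup.eq.1 (QuotientAddGroup.out_eq' ((-g : G) : G ⧸ Γ)).symm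
    rwa [neg_neg] at h
  refine ⟨_, ⟨k, rfl⟩, fun m hm => ?_⟩
  have h := hg (k + m) (Finset.mem_image.2 ⟨(k, m), Finset.mk_mem_product hk hm, rfl⟩)
  change y (k + m) = x m
  rw [← h]
  change x (g + (k + m)) = x m
  rw [← add_assoc, add_comm]
  exact hper m hm _ hgk

/-- The orbit closure of a Toeplitz array is minimal. -/
theorem IsToeplitz.isMinimal_orbitClosure {x : G → A} (hx : IsToeplitz x) :
    AddAction.IsMinimal G (orbitClosure x).carrier := by
  refine ⟨fun y => Subtype.dense_iff.2 ?_⟩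
  have himg : Subtype.val '' (AddAction.orbit G y) = Set.range fun g : G => shift g y.1 := by
    rw [AddAction.orbit, ← Set.range_comp]
    rfl
  rw [himg]
  exact orbitClosure_subset (X := orbitClosure y.1) (hx.mem_orbitClosure y.2)

end Minimality

/-! ### The substitution as an embedding of subshifts -/

section Substitution

variable {d : ℕ} {A : Type*} (R : Matrix (Fin d) (Fin d) ℤ)

/-- Coordinatewise multiplication by the diagonal entries of `R`. -/
def diagMul : (Fin d → ℤ) →+ (Fin d → ℤ) where
  toFun h i := R i i * h i
  map_zero' := funext fun _ => mul_zero _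
  map_add' _ _ := funext fun _ => mul_add _ _ _

/-- Coordinatewise quotient by the diagonal entries of `R`. -/
def quotient (g : Fin d → ℤ) : Fin d → ℤ := fun i => g i / R i i

variable {R}

theorem quotient_of_mem_box {e : Fin d → ℤ} (he : e ∈ box R) : quotient R e = 0 :=
  funext fun i => Int.ediv_eq_zero_of_lt (mem_box.1 he i).1 (mem_box.1 he i).2

variable (hR : ∀ i, 0 < R i i)
include hR

theorem remainder_add_diagMul_quotient (g : Fin d → ℤ) :
    (remainder R hR g).1 + diagMul R (quotient R g) = g :=
  funext fun i => Int.emod_add_mul_ediv (g i) (R i i)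

theorem quotient_add_diagMul (g h : Fin d → ℤ) :
    quotient R (g + diagMul R h) = quotient R g + h :=
  funext fun i => Int.add_mul_ediv_left _ _ (hR i).ne'

theorem remainder_add_diagMul (g h : Fin d → ℤ) :
    remainder R hR (g + diagMul R h) = remainder R hR g :=
  Subtype.ext <| funext fun i => Int.add_mul_emod_self_left (g i) (R i i) (h i)

theorem remainder_of_mem_box (e : box R) : remainder R hR e.1 = e :=
  Subtype.ext <| funext fun i =>
    Int.emod_eq_of_lt (mem_box.1 e.2 i).1 (mem_box.1 e.2 i).2

theorem finiteIndex_range_diagMul : (diagMul R).range.FiniteIndex := by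
  have : Finite ((Fin d → ℤ) ⧸ (diagMul R).range) := by
    refine Finite.of_surjective
      (fun e : box R => ((e.1 : Fin d → ℤ) : (Fin d → ℤ) ⧸ (diagMul R).range)) fun q => ?_
    obtain ⟨g, rfl⟩ := QuotientAddGroup.mk_surjective q
    refine ⟨remainder R hR g, QuotientAddGroup.eq.2 ⟨quotient R g, ?_⟩⟩
    rw [eq_neg_add_iff_add_eq, remainder_add_diagMul_quotient]
  exact AddSubgroup.finiteIndex_of_finite_quotient

variable (S : A → (box R → A))

theorem substitute_eq (y : (Fin d → ℤ) → A) (g : Fin d → ℤ) :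
    substitute R hR S y g = S (y (quotient R g)) (remainder R hR g) := rfl

theorem substitute_add_diagMul (y : (Fin d → ℤ) → A) (g h : Fin d → ℤ) :
    substitute R hR S y (g + diagMul R h) = S (y (quotient R g + h)) (remainder R hR g) := by
  rw [substitute_eq, quotient_add_diagMul hR, remainder_add_diagMul hR]

theorem substitute_box_add (y : (Fin d → ℤ) → A) (e : box R) (h : Fin d → ℤ) :
    substitute R hR S y (e.1 + diagMul R h) = S (y h) e := by
  rw [substitute_add_diagMul, quotient_of_mem_box e.2, remainder_of_mem_box, zero_add]

theorem shift_diagMul_substitute (y : (Fin d → ℤ) → A) (h : Fin d → ℤ) :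
    shift (diagMul R h) (substitute R hR S y) = substitute R hR S (shift h y) := funext fun g => by
  rw [shift_apply, add_comm, substitute_add_diagMul, substitute_eq, shift_apply, add_comm h]

theorem shift_substitute (y : (Fin d → ℤ) → A) (g : Fin d → ℤ) :
    shift g (substitute R hR S y) =
      shift (remainder R hR g).1 (substitute R hR S (shift (quotient R g) y)) := by
  rw [← shift_diagMul_substitute, ← shift_add, add_comm, remainder_add_diagMul_quotient]

theorem substitute_injective {S : A → (box R → A)} (hS : Function.Injective S) :
    Function.Injective (substitute R hR S) := fun y z hyz =>
  funext fun h => hS <| funext fun e => by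
    rw [← substitute_box_add hR S y, ← substitute_box_add hR S z, hyz]

theorem IsToeplitz.substitute {x : (Fin d → ℤ) → A} (hx : IsToeplitz x) :
    IsToeplitz (substitute R hR S x) := fun g => by
  obtain ⟨Γ, hΓ, hper⟩ := hx (quotient R g)
  refine ⟨Γ.map (diagMul R), ⟨?_⟩, ?_⟩
  -- The index of the image is the index of Γ ⊔ ker times that of the range.
  · rw [AddSubgroup.index_map]
    have h1 : (Γ ⊔ (diagMul R).ker).FiniteIndex := AddSubgroup.finiteIndex_of_le le_sup_left
    exact mul_ne_zero h1.index_ne_zero (finiteIndex_range_diagMul hR).index_ne_zero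
  · rintro _ ⟨γ, hγ, rfl⟩
    exact (substitute_add_diagMul hR S x g γ).trans (by rw [hper γ hγ, substitute_eq])

variable [TopologicalSpace A] [DiscreteTopology A]

theorem continuous_substitute : Continuous (Toeplitz.substitute R hR S) :=
  continuous_pi fun g =>
    (continuous_of_discreteTopology (f := fun a : A => S a (remainder R hR g))).comp
      (continuous_apply (quotient R g))

theorem substitute_mem_orbitClosure {x y : (Fin d → ℤ) → A} (hy : y ∈ (orbitClosure x).carrier) :
    Toeplitz.substitute R hR S y ∈ (orbitClosure (Toeplitz.substitute R hR S x)).carrier := by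
  refine map_mem_closure (continuous_substitute hR S) hy ?_
  rintro _ ⟨h, rfl⟩
  exact ⟨diagMul R h, shift_diagMul_substitute hR S x h⟩

/-- The finite union of these compact images is closed and contains the orbit of `x^S`, hence its
closure. -/
theorem exists_eq_shift_substitute [Finite A] {x z : (Fin d → ℤ) → A}
    (hz : z ∈ (orbitClosure (Toeplitz.substitute R hR S x)).carrier) :
    ∃ e ∈ box R, ∃ y ∈ (orbitClosure x).carrier,
      shift e (Toeplitz.substitute R hR S y) = z := by
  have hclosed : IsClosed (⋃ e ∈ box R, (fun y => shift e (Toeplitz.substitute R hR S y)) ''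
      (orbitClosure x).carrier) :=
    isClosed_biUnion_finset fun e _ => ((orbitClosure x).isClosed.isCompact.image
      ((continuous_shift e).comp (continuous_substitute hR S))).isClosed
  have hsub : (orbitClosure (Toeplitz.substitute R hR S x)).carrier ⊆
      ⋃ e ∈ box R, (fun y => shift e (Toeplitz.substitute R hR S y)) ''
        (orbitClosure x).carrier := by
    refine closure_minimal ?_ hclosed
    rintro _ ⟨g, rfl⟩
    refine Set.mem_biUnion (x := (remainder R hR g).1) (remainder R hR g).2
      ⟨shift (quotient R g) x, (orbitClosure x).mapsTo _ (self_mem_orbitClosure x), ?_⟩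
    exact (shift_substitute hR S x g).symm
  obtain ⟨e, he, y, hy, hyz⟩ := Set.mem_iUnion₂.1 (hsub hz)
  exact ⟨e, he, y, hy, hyz⟩

theorem isUniquelyErgodic_substitute [Finite A] [MeasurableSpace A] [BorelSpace A]
    {S : A → (box R → A)} (hS : Function.Injective S) {x : (Fin d → ℤ) → A}
    (hx : IsUniquelyErgodic (Fin d → ℤ) (orbitClosure x).carrier) :
    IsUniquelyErgodic (Fin d → ℤ) (orbitClosure (Toeplitz.substitute R hR S x)).carrier := by
  have := continuousConstVAdd_subshift (orbitClosure x)
  have := continuousConstVAdd_subshift (orbitClosure (Toeplitz.substitute R hR S x))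
  have hcompact : CompactSpace (orbitClosure x).carrier :=
    isCompact_iff_compactSpace.1 (orbitClosure x).isClosed.isCompact
  let s : (orbitClosure x).carrier →
      (orbitClosure (Toeplitz.substitute R hR S x)).carrier := fun y =>
    ⟨Toeplitz.substitute R hR S y.1, substitute_mem_orbitClosure hR S y.2⟩
  have hs : Continuous s := ((continuous_substitute hR S).comp continuous_subtype_val).subtype_mk _
  have hsinj : Function.Injective s := fun y z h =>
    Subtype.ext (substitute_injective hR hS (congrArg Subtype.val h))
  refine IsUniquelyErgodic.of_embedding (finiteIndex_range_diagMul hR)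
    (hs.isClosedEmbedding hsinj).measurableEmbedding
    (fun h y => Subtype.ext (shift_diagMul_substitute hR S y.1 h).symm) ?_ hx
  refine Set.eq_univ_of_forall fun z => ?_
  obtain ⟨e, -, y, hy, hyz⟩ := exists_eq_shift_substitute hR S z.2
  exact Set.mem_iUnion.2 ⟨e, ⟨y, hy⟩, Subtype.ext hyz⟩

end Substitution

/-! ### Integer boxes as Følner sequences -/

section Boxes

open scoped Pointwise symmDiff

variable {d : ℕ}

/-- The integer box with sides `c i * n` and lowest corner `0`. -/
noncomputable def scaledBox (c : Fin d → ℤ) (n : ℕ) : Finset (Fin d → ℤ) :=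
  Fintype.piFinset fun i => Finset.Ico 0 (c i * n)

theorem mem_scaledBox {c : Fin d → ℤ} {n : ℕ} {g : Fin d → ℤ} :
    g ∈ scaledBox c n ↔ ∀ i, 0 ≤ g i ∧ g i < c i * n := by
  simp [scaledBox]

theorem card_piFinset_Ico {a b : Fin d → ℤ} (hab : ∀ i, a i ≤ b i) :
    ((Fintype.piFinset fun i => Finset.Ico (a i) (b i)).card : ℝ) =
      ∏ i, ((b i : ℝ) - a i) := by
  rw [Fintype.card_piFinset, Nat.cast_prod]
  refine Finset.prod_congr rfl fun i _ => ?_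
  rw [Int.card_Ico]
  rw [← Int.cast_natCast, Int.toNat_of_nonneg (sub_nonneg.2 (hab i)), Int.cast_sub]

theorem card_box {R : Matrix (Fin d) (Fin d) ℤ} (hR : ∀ i, 0 < R i i) :
    ((box R).card : ℝ) = ∏ i, (R i i : ℝ) := by
  rw [box, card_piFinset_Ico fun i => (hR i).le]
  simp

theorem card_scaledBox {c : Fin d → ℤ} (hc : ∀ i, 0 < c i) (n : ℕ) :
    ((scaledBox c n).card : ℝ) = (∏ i, (c i : ℝ)) * (n : ℝ) ^ d := by
  rw [scaledBox, card_piFinset_Ico fun i => mul_nonneg (hc i).le (Nat.cast_nonneg n)]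
  simp [Finset.prod_mul_distrib]

/-- F and g + F have equal size inside E, so each difference has at most #E - #F points; the
additive form avoids subtraction in ℕ. -/
theorem card_symmDiff_vadd_add_le {G : Type*} [AddCommGroup G] [DecidableEq G] {g : G}
    {F E : Finset G} (hF : F ⊆ E) (hgF : g +ᵥ F ⊆ E) :
    ((g +ᵥ F) ∆ F).card + 2 * F.card ≤ 2 * E.card := by
  have h1 : ((g +ᵥ F) ∆ F).card = ((g +ᵥ F) \ F).card + (F \ (g +ᵥ F)).card :=
    Finset.card_union_of_disjoint disjoint_sdiff_sdiff
  have h2 := Finset.card_sdiff_add_card (g +ᵥ F) F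
  have h3 := Finset.card_sdiff_add_card F (g +ᵥ F)
  have h4 := Finset.card_le_card (Finset.union_subset hgF hF)
  have h5 := Finset.card_le_card (Finset.union_subset hF hgF)
  have h6 : (g +ᵥ F).card = F.card := Finset.card_vadd_finset g F
  omega

theorem isAddFoelner_scaledBox {c : Fin d → ℤ} (hc : ∀ i, 0 < c i) :
    IsAddFoelner (Fin d → ℤ) (Measure.count : Measure (Fin d → ℤ)) atTop
      (fun n => (scaledBox c n : Set (Fin d → ℤ))) := by
  classical
  have hpos : ∀ n : ℕ, 0 < n → (0 : ℝ) < (scaledBox c n).card := fun n hn => by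
    rw [card_scaledBox hc]
    have : ∀ i, (0 : ℝ) < c i := fun i => by exact_mod_cast hc i
    exact mul_pos (Finset.prod_pos fun i _ => this i) (by positivity)
  refine (isAddFoelner_count_iff _).2 ⟨?_, fun g => ?_⟩
  · filter_upwards [eventually_gt_atTop 0] with n hn
    exact Finset.card_pos.1 (by exact_mod_cast hpos n hn)
  -- Widening by |g i| on both sides contains the box and its translate, at relative cost tending to
  -- zero.
  let E : ℕ → Finset (Fin d → ℤ) := fun n =>
    Fintype.piFinset fun i => Finset.Ico (-|g i|) (c i * n + |g i|)
  have hE : ∀ n : ℕ, ((E n).card : ℝ) = ∏ i, ((c i : ℝ) * n + 2 * |(g i : ℝ)|) := fun n => by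
    have : ∀ i, -|g i| ≤ c i * n + |g i| := fun i => by
      have := mul_nonneg (hc i).le (Nat.cast_nonneg (α := ℤ) n)
      have := abs_nonneg (g i)
      omega
    rw [card_piFinset_Ico this]
    refine Finset.prod_congr rfl fun i _ => ?_
    push_cast
    ring
  have hlim : Tendsto (fun n : ℕ => ∏ i, (1 + 2 * |(g i : ℝ)| / c i * (n : ℝ)⁻¹)) atTop
      (𝓝 (∏ _i : Fin d, (1 : ℝ))) := by
    refine tendsto_finsetProd _ fun i _ => ?_
    simpa using ((tendsto_inv_atTop_nhds_zero_nat (𝕜 := ℝ)).const_mul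
      (2 * |(g i : ℝ)| / c i)).const_add 1
  rw [Finset.prod_const_one] at hlim
  have hlim2 := (hlim.sub_const 1).const_mul 2
  rw [sub_self, mul_zero] at hlim2
  refine squeeze_zero' (.of_forall fun n => by positivity) ?_ hlim2
  filter_upwards [eventually_gt_atTop 0] with n hn
  have hsub1 : scaledBox c n ⊆ E n := fun h hh => by
    rw [mem_scaledBox] at hh
    refine Fintype.mem_piFinset.2 fun i => Finset.mem_Ico.2 ?_
    have := hh i
    have := abs_nonneg (g i)
    omega
  have hsub2 : g +ᵥ scaledBox c n ⊆ E n := fun h hh => by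
    obtain ⟨k, hk, rfl⟩ := Finset.mem_vadd_finset.1 hh
    rw [mem_scaledBox] at hk
    refine Fintype.mem_piFinset.2 fun i => Finset.mem_Ico.2 ?_
    have := hk i
    have := le_abs_self (g i)
    have := neg_abs_le (g i)
    change -|g i| ≤ g i + k i ∧ g i + k i < _
    omega
  have hratio : ((E n).card : ℝ) / (scaledBox c n).card =
      ∏ i, (1 + 2 * |(g i : ℝ)| / c i * (n : ℝ)⁻¹) := by
    have hn0 : (n : ℝ) ≠ 0 := by exact_mod_cast hn.ne'
    rw [hE, scaledBox, card_piFinset_Ico fun i => mul_nonneg (hc i).le (Nat.cast_nonneg n),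
      ← Finset.prod_div_distrib]
    refine Finset.prod_congr rfl fun i _ => ?_
    have hci : (c i : ℝ) ≠ 0 := by exact_mod_cast (hc i).ne'
    push_cast
    field_simp
    ring
  rw [← hratio, div_le_iff₀ (hpos n hn), mul_assoc, sub_mul, div_mul_cancel₀ _ (hpos n hn).ne']
  have h : (((g +ᵥ scaledBox c n) ∆ scaledBox c n).card : ℝ) + 2 * (scaledBox c n).card ≤
      2 * (E n).card := by exact_mod_cast card_symmDiff_vadd_add_le hsub1 hsub2
  linarith

end Boxes

/-! ### Entropy of the substituted subshift -/

section SubstitutionEntropy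

variable {d : ℕ} {A : Type*} [Finite A]

theorem patternCount_image_le {G H : Type*} {Y : Set (H → A)} (f : (H → A) → (G → A))
    {M : Finset G} {N : Finset H}
    (hf : ∀ y ∈ Y, ∀ z ∈ Y, (∀ n ∈ N, y n = z n) → ∀ m ∈ M, f y m = f z m) :
    patternCount (f '' Y) M ≤ patternCount Y N := by
  rcases Y.eq_empty_or_nonempty with rfl | ⟨y₀, hy₀⟩
  · rw [Set.image_empty, patternCount_empty_left]
    exact Nat.zero_le _
  have : Nonempty (H → A) := ⟨y₀⟩
  have hmem : ∀ z ∈ f '' Y, Function.invFunOn f Y z ∈ Y := fun z hz => Function.invFunOn_mem hz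
  refine patternCount_le_of_determines (Function.invFunOn f Y) hmem fun y hy z hz h m hm => ?_
  rw [← Function.invFunOn_eq hy, ← Function.invFunOn_eq hz]
  exact hf _ (hmem y hy) _ (hmem z hz) h m hm

variable [TopologicalSpace A] [DiscreteTopology A] {R : Matrix (Fin d) (Fin d) ℤ}
  (hR : ∀ i, 0 < R i i)

/-- The scaled box is tiled by the blocks indexed by the cube of side n, and S, being injective,
lets each letter be recovered from its block. -/
theorem patternCount_le_patternCount_substitute {S : A → (box R → A)}
    (hS : Function.Injective S) (x : (Fin d → ℤ) → A) (n : ℕ) :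
    patternCount (orbitClosure x).carrier (scaledBox (fun _ => 1) n) ≤
      patternCount (orbitClosure (substitute R hR S x)).carrier
        (scaledBox (fun i => R i i) n) := by
  refine patternCount_le_of_determines (substitute R hR S)
    (fun y hy => substitute_mem_orbitClosure hR S hy) fun y _ z _ h m hm => ?_
  refine hS (funext fun e => ?_)
  rw [← substitute_box_add hR S y, ← substitute_box_add hR S z]
  refine h _ (mem_scaledBox.2 fun i => ?_)
  have he := mem_box.1 e.2 i
  have hm := mem_scaledBox.1 hm i
  have h1 := mul_nonneg (hR i).le hm.1
  have h2 : R i i * m i ≤ R i i * (n - 1) :=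
    mul_le_mul_of_nonneg_left (by omega) (hR i).le
  rw [mul_sub, mul_one] at h2
  change 0 ≤ e.1 i + R i i * m i ∧ e.1 i + R i i * m i < _
  constructor <;> linarith [he.1, he.2]

/-- The factor counts the offsets e. A window displaced by e meets up to n + 1 blocks along each
axis, whence the larger cube. -/
theorem patternCount_substitute_le (S : A → (box R → A)) (x : (Fin d → ℤ) → A) (n : ℕ) :
    patternCount (orbitClosure (substitute R hR S x)).carrier (scaledBox (fun i => R i i) n) ≤
      (box R).card * patternCount (orbitClosure x).carrier (scaledBox (fun _ => 1) (n + 1)) := by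
  refine (patternCount_iUnion_le (box R)
    (fun e => (fun y => shift e (substitute R hR S y)) '' (orbitClosure x).carrier)
    (fun z hz => exists_eq_shift_substitute hR S hz) _).trans ?_
  rw [← smul_eq_mul]
  refine Finset.sum_le_card_nsmul _ _ _ fun e he => ?_
  refine patternCount_image_le _ fun y _ z _ h m hm => ?_
  rw [shift_apply, shift_apply, substitute_eq, substitute_eq, h]
  refine mem_scaledBox.2 fun i => ?_
  have he := mem_box.1 he i
  have hm := mem_scaledBox.1 hm i
  change 0 ≤ (e i + m i) / R i i ∧ (e i + m i) / R i i < _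
  refine ⟨Int.ediv_nonneg (by linarith) (hR i).le, Int.ediv_lt_of_lt_mul (hR i) ?_⟩
  push_cast
  linarith

theorem entropy_substitute (hd : 1 ≤ d) {S : A → (box R → A)} (hS : Function.Injective S)
    (x : (Fin d → ℤ) → A) {h h' : ℝ} (hx : HasTopEntropy (orbitClosure x) h)
    (hx' : HasTopEntropy (orbitClosure (substitute R hR S x)) h') :
    h' = h / (box R).card := by
  have hD : (0 : ℝ) < (box R).card := by
    rw [card_box hR]
    exact Finset.prod_pos fun i _ => by exact_mod_cast hR i
  set D : ℝ := ((box R).card : ℝ) with hDdef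
  let p : ℕ → ℝ := fun n =>
    Real.log (patternCount (orbitClosure x).carrier (scaledBox (fun _ => 1) n))
  let q : ℕ → ℝ := fun n => Real.log
    (patternCount (orbitClosure (substitute R hR S x)).carrier (scaledBox (fun i => R i i) n))
  have hp : Tendsto (fun n => p n / (n : ℝ) ^ d) atTop (𝓝 h) := by
    refine (hx _ (isAddFoelner_scaledBox fun _ => one_pos)).congr fun n => ?_
    rw [card_scaledBox fun _ => one_pos]
    simp [p, patternCount, patterns, blocks]
  have hq : Tendsto (fun n => q n / (D * (n : ℝ) ^ d)) atTop (𝓝 h') := by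
    refine (hx' _ (isAddFoelner_scaledBox hR)).congr fun n => ?_
    rw [card_scaledBox hR, ← card_box hR]
    rfl
  have hpx : ∀ M, (0 : ℝ) < patternCount (orbitClosure x).carrier M := fun M => by
    exact_mod_cast patternCount_pos ⟨x, self_mem_orbitClosure x⟩ M
  have hpy : ∀ M, (0 : ℝ) < patternCount (orbitClosure (substitute R hR S x)).carrier M :=
    fun M => by exact_mod_cast patternCount_pos ⟨_, self_mem_orbitClosure _⟩ M
  have hlow : ∀ n, p n ≤ q n := fun n => Real.log_le_log (hpx _) (by
    exact_mod_cast patternCount_le_patternCount_substitute hR hS x n)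
  have hupp : ∀ n, q n ≤ Real.log D + p (n + 1) := fun n => by
    rw [← Real.log_mul hD.ne' (hpx _).ne']
    exact Real.log_le_log (hpy _) (by
      rw [hDdef]; exact_mod_cast patternCount_substitute_le hR S x n)
  -- The upper bound for q n, with p (n + 1) normalised by its own volume. The term log D vanishes
  -- in the limit because d ≥ 1.
  have hlim : Tendsto (fun n : ℕ => (Real.log D * ((n : ℝ) ^ d)⁻¹ +
      p (n + 1) / ((n + 1 : ℕ) : ℝ) ^ d * (1 + (n : ℝ)⁻¹) ^ d) / D) atTop (𝓝 (h / D)) := by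
    have hinv : Tendsto (fun n : ℕ => (n : ℝ)⁻¹) atTop (𝓝 0) := tendsto_inv_atTop_nhds_zero_nat
    have h1 : Tendsto (fun n : ℕ => Real.log D * ((n : ℝ) ^ d)⁻¹) atTop (𝓝 0) := by
      simpa [inv_pow, Nat.one_le_iff_ne_zero.1 hd] using (hinv.pow d).const_mul (Real.log D)
    have h2 : Tendsto (fun n : ℕ => (1 + (n : ℝ)⁻¹) ^ d) atTop (𝓝 1) := by
      simpa using (hinv.const_add 1).pow d
    have h3 := (tendsto_add_atTop_iff_nat (f := fun n => p n / (n : ℝ) ^ d) 1).2 hp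
    simpa using (h1.add (h3.mul h2)).div_const D
  refine le_antisymm (le_of_tendsto_of_tendsto hq hlim ?_)
    (le_of_tendsto_of_tendsto (hp.div_const D) hq ?_)
  · filter_upwards [eventually_gt_atTop 0] with n hn
    have hn0 : (0 : ℝ) < n := by exact_mod_cast hn
    have hrw : p (n + 1) / ((n + 1 : ℕ) : ℝ) ^ d * (1 + (n : ℝ)⁻¹) ^ d =
        p (n + 1) / (n : ℝ) ^ d := by
      have : (1 + (n : ℝ)⁻¹) = ((n + 1 : ℕ) : ℝ) / n := by push_cast; field_simp
      rw [this, div_pow]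
      have : (((n + 1 : ℕ) : ℝ) ^ d) ≠ 0 := by positivity
      field_simp
    rw [hrw, ← div_eq_mul_inv, ← add_div, div_div, mul_comm D]
    gcongr
    exact hupp n
  · filter_upwards with n
    rw [div_div, mul_comm D]
    gcongr
    exact hlow n

end SubstitutionEntropy
end Toeplitz

theorem mainTheorem6 {d : ℕ} (hd : 1 ≤ d)
    {A : Type*} [Finite A] [TopologicalSpace A] [DiscreteTopology A]
    [MeasurableSpace A] [BorelSpace A]
    (x : (Fin d → ℤ) → A) (hx : Toeplitz.IsToeplitz x)
    (P : ℕ → Matrix (Fin d) (Fin d) ℤ) (hscale : Toeplitz.IsScale P)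
    (hdiag : ∀ n, (P n).IsDiag) (hpos : ∀ n i, 0 < P n i i)
    (hper : Toeplitz.IsPeriodStructure x fun n => Toeplitz.latticeOf (P n))
    (hstrict : Toeplitz.IsStrictlyErgodic (Fin d → ℤ) (Toeplitz.orbitClosure x).carrier)
    (R : Matrix (Fin d) (Fin d) ℤ) (hRdiag : R.IsDiag) (hRpos : ∀ i, 0 < R i i)
    (S : A → (Toeplitz.box R → A)) (hS : Function.Injective S) :
    Toeplitz.IsToeplitz (Toeplitz.substitute R hRpos S x) ∧
    Toeplitz.IsStrictlyErgodic (Fin d → ℤ)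
      (Toeplitz.orbitClosure (Toeplitz.substitute R hRpos S x)).carrier ∧
    ∃ h : ℝ, Toeplitz.HasTopEntropy (Toeplitz.orbitClosure x) h ∧
      Toeplitz.HasTopEntropy (Toeplitz.orbitClosure (Toeplitz.substitute R hRpos S x))
        (h / ((Toeplitz.box R).card : ℝ)) := by
  have hxS := hx.substitute hRpos S
  have hX := Toeplitz.hasTopEntropy_iInf
    (X := Toeplitz.orbitClosure x) ⟨x, Toeplitz.self_mem_orbitClosure x⟩
  have hY := Toeplitz.hasTopEntropy_iInf
    (X := Toeplitz.orbitClosure (Toeplitz.substitute R hRpos S x))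
    ⟨_, Toeplitz.self_mem_orbitClosure _⟩
  refine ⟨hxS, ⟨hxS.isMinimal_orbitClosure,
    Toeplitz.isUniquelyErgodic_substitute hRpos hS hstrict.2⟩, _, hX, ?_⟩
  -- The entropy of Y already exists as an infimum; only its value remains to be identified.
  rw [← Toeplitz.entropy_substitute hRpos hd hS x hX hY]
  exact hY
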